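/- Let $M$ be a point process on $\mathbb R^d$, regarded as a random locally finite subset $[M]\subset\mathbb R^d$, whose law is invariant under all isometries of $\mathbb R^d$ and which has finite intensity (the expected number of points in every bounded Borel set is finite). For every $k\ge 0$ let $V_k\subseteq[M]$ be a subset chosen as a measurable, isometry-equivariant function of the configuration $[M]$, such that almost surely $V_k\neq\emptyset$ whenever $[M]\ne\emptyset$, and any two distinct points of $V_k$ are at distance at least $2^k$. The Voronoi cell of $v\in V_k$ is $\{x\in\mathbb R^d: |x-v|\le |x-w| \text{ for all } w\in V_k\}$; let $B_k$ be the union of the topological boundaries of the Voronoi cells on $V_k$. Define a partition $\mathcal P_k$ of $[M]$ by putting two distinct points $x,y\in[M]$ in the same class if and only if they lie in the same connected component of $\mathbb R^d\setminus\bigcup_{i\ge k}B_i$ (so a point of $[M]$ lying on $\bigcup_{i\ge k}B_i$ forms a class by itself). Then $(\mathcal P_k)_{k\ge0}$ is a connected, locally finite clumping on $[M]$. That is: almost surely, for every $k$, $\mathcal P_{k+1}$ is coarser than (or equal to) $\mathcal P_k$ and all classes of $\mathcal P_k$ are finite; the partitions are measurable and isometry-equivariant functions of $[M]$ (almost surely,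 for every $k$ and every isometry $\gamma$, the partition $\mathcal P_k$ of $\gamma[M]$ is the image under $\gamma$ of the partition $\mathcal P_k$ of $[M]$); and, almost surely, for any two points $x,y\in[M]$ there is a $k$ such that $x$ and $y$ are in the same class of $\mathcal P_k$. -/

import Mathlib

open MeasureTheory Set
open scoped ENNReal

namespace PointProcess

/-- Euclidean space `ℝ^d` with the Euclidean distance. -/
abbrev Space (d : ℕ) : Type := EuclideanSpace ℝ (Fin d)

/-- A point configuration `[M]`: a subset of `ℝ^d` with finitely many points in every bounded
set. -/
@[ext]
structure Config (d : ℕ) where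
  /-- the set of points of the configuration -/
  pts : Set (Space d)
  /-- local finiteness -/
  finite_inter : ∀ B : Set (Space d), Bornology.IsBounded B → (pts ∩ B).Finite

namespace Config

/-- The number of points of the configuration `ω` in the set `B`. -/
noncomputable def count {d : ℕ} (B : Set (Space d)) (ω : Config d) : ℝ≥0∞ :=
  ((ω.pts ∩ B).encard : ℝ≥0∞)

/-- The usual σ-algebra on configurations, generated by the counts in Borel sets. -/
noncomputable instance instMeasurableSpace (d : ℕ) : MeasurableSpace (Config d) :=
  ⨆ B : {B : Set (Space d) // MeasurableSet B},
    MeasurableSpace.comap (count B.1) inferInstance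

/-- The image `γ ω` of a configuration under an isometry `γ` of `ℝ^d`. -/
noncomputable def map {d : ℕ} (γ : Space d ≃ᵢ Space d) (ω : Config d) : Config d where
  pts := γ '' ω.pts
  finite_inter := by
    intro B hB
    have hB' : Bornology.IsBounded (γ.symm '' B) := γ.symm.isometry.lipschitz.isBounded_image hB
    refine ((ω.finite_inter _ hB').image γ).subset ?_
    rintro _ ⟨⟨x, hx, rfl⟩, hxB⟩
    exact ⟨x, ⟨hx, γ x, hxB, by simp⟩, rfl⟩

/-- A point of `ω`, moved by `γ`, as a point of `γ ω`. -/
noncomputable def mapPt {d : ℕ} (γ : Space d ≃ᵢ Space d) (ω : Config d) (x : ω.pts) : (ω.map γ).pts :=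
  ⟨γ x, mem_image_of_mem γ x.2⟩

theorem measurable_count {d : ℕ} {B : Set (Space d)} (hB : MeasurableSet B) :
    Measurable (count B) := by
  have h : MeasurableSpace.comap (count B) inferInstance ≤ instMeasurableSpace d :=
    le_iSup (fun B : {B : Set (Space d) // MeasurableSet B} =>
      MeasurableSpace.comap (count B.1) inferInstance) ⟨B, hB⟩
  exact measurable_iff_comap_le.2 h

theorem count_map {d : ℕ} (γ : Space d ≃ᵢ Space d) (B : Set (Space d)) (ω : Config d) :
    count B (ω.map γ) = count (γ ⁻¹' B) ω := by
  have h : (ω.map γ).pts ∩ B = γ '' (ω.pts ∩ γ ⁻¹' B) := (image_inter_preimage _ _ _).symm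
  rw [count, count, h, γ.injective.encard_image]

theorem measurable_map {d : ℕ} (γ : Space d ≃ᵢ Space d) : Measurable (map γ) := by
  refine measurable_iff_comap_le.2 ?_
  rw [instMeasurableSpace, MeasurableSpace.comap_iSup]
  refine iSup_le fun B => ?_
  rw [MeasurableSpace.comap_comp, ← measurable_iff_comap_le]
  have h : count B.1 ∘ map γ = count (γ ⁻¹' B.1) := funext fun ω => count_map γ B.1 ω
  rw [h]
  exact measurable_count (γ.continuous.measurable B.2)

end Config

/-- The law `μ` of a point process is invariant under all isometries of `ℝ^d`. -/
def IsometryInvariant {d : ℕ} (μ : Measure (Config d)) : Prop :=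
  ∀ γ : Space d ≃ᵢ Space d, μ.map (Config.map γ) = μ

/-- Finite intensity: the expected number of points in any bounded Borel set is finite. -/
def FiniteIntensity {d : ℕ} (μ : Measure (Config d)) : Prop :=
  ∀ B : Set (Space d), Bornology.IsBounded B → MeasurableSet B →
    ∫⁻ ω, Config.count B ω ∂μ < ∞

/-- `V` chooses, in an equivariant and measurable way, a subset of the points of the
configuration (for almost every configuration). -/
structure IsEquivariantSubset {d : ℕ} (μ : Measure (Config d)) (V : Config d → Config d) :
    Prop where
  aemeasurable : AEMeasurable V μ
  subset : ∀ᵐ ω ∂μ, (V ω).pts ⊆ ω.pts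
  equivariant : ∀ᵐ ω ∂μ, ∀ γ : Space d ≃ᵢ Space d, V (ω.map γ) = (V ω).map γ

/-- The (closed) Voronoi cell of `v` with respect to the set of sites `S`. -/
def voronoiCell {d : ℕ} (S : Set (Space d)) (v : Space d) : Set (Space d) :=
  {x | ∀ w ∈ S, dist x v ≤ dist x w}

/-- The union of the boundaries of the Voronoi cells on `S`. -/
def voronoiBoundary {d : ℕ} (S : Set (Space d)) : Set (Space d) :=
  ⋃ v ∈ S, frontier (voronoiCell S v)

/-- The set `ℝ^d ∖ ⋃_{i ≥ k} B_i`, where `B_i` is the union of the boundaries of the Voronoi cells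
on `V i ω`. -/
def boundaryCompl {d : ℕ} (V : ℕ → Config d → Config d) (k : ℕ) (ω : Config d) :
    Set (Space d) :=
  (⋃ i ≥ k, voronoiBoundary (V i ω).pts)ᶜ

/-- The partition `P_k` of the points of `ω`: two points are in the same clump iff they are in the
same connected component of `ℝ^d ∖ ⋃_{i ≥ k} B_i`. A point that lies on some `B_i`, `i ≥ k`, is in
no component and forms a clump on its own (`connectedComponentIn F x` is empty for `x ∉ F`). -/
def clumps {d : ℕ} (V : ℕ → Config d → Config d) (k : ℕ) (ω : Config d) : Setoid ω.pts where
  r x y := x = y ∨ (y : Space d) ∈ connectedComponentIn (boundaryCompl V k ω) x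
  iseqv := by
    refine ⟨fun x => Or.inl rfl, ?_, ?_⟩
    · rintro x y (h | h)
      · exact Or.inl h.symm
      · refine Or.inr ?_
        have hx : (x : Space d) ∈ boundaryCompl V k ω :=
          connectedComponentIn_nonempty_iff.1 ⟨_, h⟩
        rw [← connectedComponentIn_eq h]
        exact mem_connectedComponentIn hx
    · rintro x y z (rfl | h) (rfl | h')
      · exact Or.inl rfl
      · exact Or.inr h'
      · exact Or.inr h
      · refine Or.inr ?_
        rw [connectedComponentIn_eq h]
        exact h'

/-- A locally finite clumping of the point process with law `μ`: a sequence of coarser and coarser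
partitions of the points of the configuration (given by equivalence relations), defined in an
isometry-equivariant and measurable way, all of whose classes are finite, almost surely.

Measurability: the set of pairs of points in a common class is locally finite in `ℝ^d × ℝ^d`, and
the σ-algebra of such sets is generated by the events that the set hits a rectangle `A × A'`. -/
structure IsLocallyFiniteClumping {d : ℕ} (μ : Measure (Config d))
    (P : ℕ → (ω : Config d) → Setoid ω.pts) : Prop where
  coarser : ∀ᵐ ω ∂μ, ∀ k, P k ω ≤ P (k + 1) ω
  finite : ∀ᵐ ω ∂μ, ∀ k, ∀ x : ω.pts, {y : ω.pts | P k ω x y}.Finite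
  equivariant : ∀ᵐ ω ∂μ, ∀ γ : Space d ≃ᵢ Space d, ∀ k, ∀ x y : ω.pts,
    P k (ω.map γ) (ω.mapPt γ x) (ω.mapPt γ y) ↔ P k ω x y
  measurable : ∀ k, ∀ A A' : Set (Space d), MeasurableSet A → MeasurableSet A' →
    NullMeasurableSet
      {ω : Config d | ∃ x y : ω.pts, (x : Space d) ∈ A ∧ (y : Space d) ∈ A' ∧ P k ω x y} μ

/-- A clumping is connected if almost surely any two points of the configuration are in the same
clump of one of the partitions. -/
def IsConnectedClumping {d : ℕ} (μ : Measure (Config d))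
    (P : ℕ → (ω : Config d) → Setoid ω.pts) : Prop :=
  ∀ᵐ ω ∂μ, ∀ x y : ω.pts, ∃ k, P k ω x y

end PointProcess

/-! The heart is that almost surely every ball meets only finitely many of the sets `B_k`. Let the
sites be `2 * r`-separated. Every Voronoi cell is convex and contains the ball of radius `r` about
its site, so shrinking it towards the site by the factor `1 - t` leaves a margin of `t * r` inside
the cell. The shrunken cells occupy a fraction `(1 - t) ^ d` of the volume and stay `t * r` away
from the boundaries. Counting unit cubes in a large box and averaging by stationarity bounds the
probability that the `R`-ball at the origin meets the boundary by `1 - (1 - t) ^ d ≤ d * t`, where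
`t = (R + √d) / r` (`Config.card_near_boundary_add_le`, `IsStationary.measure_nearBoundary_le`).
With `r = 2 ^ k / 2` this is summable in `k`, and Borel–Cantelli applies
(`ae_eventually_not_nearBoundary`).

Connectedness follows: a ball containing both points avoids `B_i` for all large `i`. The complements
of the boundaries are also open, so their components can be described by finite chains of rational
balls, which gives measurability.

Classes are finite because a component lies in a single cell of `V_k`, and these cells are bounded:
by stationarity, a nonempty set of sites has points arbitrarily deep in every orthant
(`IsStationary.ae_hit_orthant`). -/

namespace PointProcess

/-! ### Geometry of Voronoi cells -/

section Geometry

variable {d : ℕ}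

open scoped InnerProductSpace

/-- The quadratic term in `x` cancels, so the condition is affine in `x` and cells are intersections
of half-spaces. -/
theorem dist_le_dist_iff_inner (x v w : Space d) :
    dist x v ≤ dist x w ↔ 2 * ⟪x, w - v⟫_ℝ ≤ ‖w‖ ^ 2 - ‖v‖ ^ 2 := by
  rw [dist_eq_norm, dist_eq_norm, ← sq_le_sq₀ (norm_nonneg _) (norm_nonneg _),
    norm_sub_sq_real, norm_sub_sq_real, inner_sub_right]
  constructor <;> intro h <;> linarith

theorem mem_voronoiCell_iff_inner {S : Set (Space d)} {x v : Space d} :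
    x ∈ voronoiCell S v ↔ ∀ w ∈ S, 2 * ⟪x, w - v⟫_ℝ ≤ ‖w‖ ^ 2 - ‖v‖ ^ 2 :=
  forall₂_congr fun w _ => dist_le_dist_iff_inner x v w

theorem convex_voronoiCell (S : Set (Space d)) (v : Space d) : Convex ℝ (voronoiCell S v) := by
  intro x hx y hy a b ha hb hab
  rw [mem_voronoiCell_iff_inner] at *
  intro w hw
  have h1 := mul_le_mul_of_nonneg_left (hx w hw) ha
  have h2 := mul_le_mul_of_nonneg_left (hy w hw) hb
  rw [inner_add_left, inner_smul_left, inner_smul_left]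
  simp only [conj_trivial]
  have : a * (‖w‖ ^ 2 - ‖v‖ ^ 2) + b * (‖w‖ ^ 2 - ‖v‖ ^ 2) = ‖w‖ ^ 2 - ‖v‖ ^ 2 := by
    rw [← add_mul, hab, one_mul]
  linarith

theorem isClosed_voronoiCell (S : Set (Space d)) (v : Space d) : IsClosed (voronoiCell S v) := by
  have : voronoiCell S v = ⋂ w ∈ S, {x | dist x v ≤ dist x w} := by
    ext x; simp [voronoiCell]
  rw [this]
  exact isClosed_biInter fun w _ => isClosed_le (by fun_prop) (by fun_prop)

/-- Moving a point towards its nearest site makes that site strictly nearest. -/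
theorem dist_lt_dist_of_lineMap {x u w : Space d} (h : dist x u ≤ dist x w) (huw : u ≠ w)
    {ε : ℝ} (h0 : 0 < ε) (h1 : ε ≤ 1) :
    dist (AffineMap.lineMap x u ε) u < dist (AffineMap.lineMap x u ε) w := by
  rw [← not_le, dist_le_dist_iff_inner, not_le, AffineMap.lineMap_apply_module, inner_add_left,
    inner_smul_left, inner_smul_left]
  simp only [conj_trivial]
  rw [dist_le_dist_iff_inner] at h
  have h2 := mul_le_mul_of_nonneg_left h (sub_nonneg.2 h1)
  have h3 : 0 < ‖w - u‖ ^ 2 := by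
    have := norm_pos_iff.2 (sub_ne_zero.2 huw.symm); positivity
  rw [norm_sub_sq_real] at h3
  have e1 : ⟪x, u - w⟫_ℝ = - ⟪x, w - u⟫_ℝ := by rw [← inner_neg_right, neg_sub]
  have e2 : ⟪u, u - w⟫_ℝ = ‖u‖ ^ 2 - ⟪w, u⟫_ℝ := by
    rw [inner_sub_right, real_inner_self_eq_norm_sq, real_inner_comm]
  rw [e1, e2]
  -- The inequality holds with slack `ε * ‖w - u‖ ^ 2`.
  nlinarith [mul_pos h0 h3]

theorem tendsto_lineMap_nhdsGT (x u : Space d) :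
    Filter.Tendsto (fun ε : ℝ => AffineMap.lineMap x u ε) (nhdsWithin 0 (Ioi 0)) (nhds x) := by
  have h : Continuous fun ε : ℝ => (AffineMap.lineMap x u ε : Space d) :=
    AffineMap.lineMap_continuous
  simpa using (h.tendsto 0).mono_left nhdsWithin_le_nhds

/-- Arbitrarily close to a point of the cell of `u` there are points with `u` as strictly
nearest site. -/
theorem exists_strictly_nearest {S : Set (Space d)} {x u : Space d} (hx : x ∈ voronoiCell S u)
    {B : Set (Space d)} (hB : B ∈ nhds x) :
    ∃ y ∈ B, ∀ w ∈ S, w ≠ u → dist y u < dist y w := by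
  have h1 : ∀ᶠ ε in nhdsWithin (0 : ℝ) (Ioi 0), AffineMap.lineMap x u ε ∈ B :=
    tendsto_lineMap_nhdsGT x u hB
  have h2 : ∀ᶠ ε in nhdsWithin (0 : ℝ) (Ioi 0), ε ∈ Ioc (0 : ℝ) 1 := Ioc_mem_nhdsGT one_pos
  obtain ⟨ε, hε, h0, h3⟩ := (h1.and h2).exists
  exact ⟨_, hε, fun w hw hwu => dist_lt_dist_of_lineMap (hx w hw) hwu.symm h0 h3⟩

/-- Near a point of the cell of `u` there are points strictly nearest to `u`, and these cannot
belong to the cell of another site. -/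
theorem eq_of_mem_interior_voronoiCell {S : Set (Space d)} {x u v : Space d} (hv : v ∈ S)
    (hu : u ∈ S) (hxv : x ∈ interior (voronoiCell S v)) (hxu : x ∈ voronoiCell S u) : v = u := by
  by_contra hne
  obtain ⟨y, hy, hyu⟩ := exists_strictly_nearest hxu (mem_interior_iff_mem_nhds.1 hxv)
  exact (hyu v hv hne).not_ge (hy u hu)

theorem disjoint_interior_voronoiBoundary {S : Set (Space d)} {v : Space d} (hv : v ∈ S) :
    Disjoint (interior (voronoiCell S v)) (voronoiBoundary S) := by
  rw [Set.disjoint_left]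
  intro x hx hb
  obtain ⟨u, hu, hxu⟩ := mem_iUnion₂.1 hb
  obtain rfl := eq_of_mem_interior_voronoiCell hv hu hx ((isClosed_voronoiCell S u).frontier_subset hxu)
  exact hxu.2 hx

/-- On `B` the cell agrees with its interior, so its trace on `B` is relatively clopen. -/
theorem subset_voronoiCell_of_isPreconnected {S B : Set (Space d)} (hB : IsPreconnected B)
    (hd : Disjoint B (voronoiBoundary S)) {v x : Space d} (hv : v ∈ S) (hx : x ∈ B)
    (hxv : x ∈ voronoiCell S v) : B ⊆ voronoiCell S v := by
  have hint : ∀ z ∈ B, z ∈ voronoiCell S v → z ∈ interior (voronoiCell S v) := fun z hz hzv => by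
    by_contra h
    exact Set.disjoint_left.1 hd hz (mem_iUnion₂.2 ⟨v, hv, subset_closure hzv, h⟩)
  intro y hyB
  by_contra hy
  obtain ⟨z, -, hz1, hz2⟩ := hB (interior (voronoiCell S v)) (voronoiCell S v)ᶜ isOpen_interior
    (isClosed_voronoiCell S v).isOpen_compl
    (fun z hz => (em (z ∈ voronoiCell S v)).imp (hint z hz) id)
    ⟨x, hx, hint x hx hxv⟩ ⟨y, hyB, hy⟩
  exact hz2 (interior_subset hz1)

theorem Config.exists_mem_voronoiCell (S : Config d) (hS : S.pts.Nonempty) (x : Space d) :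
    ∃ v ∈ S.pts, x ∈ voronoiCell S.pts v := by
  obtain ⟨w, hw⟩ := hS
  have hfin := S.finite_inter (Metric.closedBall x (dist x w)) Metric.isBounded_closedBall
  obtain ⟨v, ⟨hv, hvb⟩, hmin⟩ := Set.exists_min_image _ (fun u => dist x u) hfin
    ⟨w, hw, by simp [dist_comm]⟩
  refine ⟨v, hv, fun u hu => ?_⟩
  by_cases h : dist x u ≤ dist x w
  · exact hmin u ⟨hu, by simpa [dist_comm] using h⟩
  · rw [Metric.mem_closedBall, dist_comm] at hvb
    linarith

theorem Config.mem_interior_voronoiCell (S : Config d) {x v : Space d} (hv : v ∈ S.pts)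
    (hxv : x ∈ voronoiCell S.pts v) (hx : x ∉ voronoiBoundary S.pts) :
    x ∈ interior (voronoiCell S.pts v) := by
  by_contra h
  exact hx (mem_iUnion₂.2 ⟨v, hv, subset_closure hxv, h⟩)

/-- If there are sites, each point off the boundary is interior to the cell of a nearest site, and
that interior is disjoint from the whole boundary. -/
theorem Config.isClosed_voronoiBoundary (S : Config d) : IsClosed (voronoiBoundary S.pts) := by
  rcases S.pts.eq_empty_or_nonempty with h | h
  · simp [h, voronoiBoundary]
  rw [← isOpen_compl_iff, isOpen_iff_mem_nhds]
  intro x hx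
  obtain ⟨v, hv, hxv⟩ := S.exists_mem_voronoiCell h x
  exact Filter.mem_of_superset (isOpen_interior.mem_nhds (S.mem_interior_voronoiCell hv hxv hx))
    (disjoint_interior_voronoiBoundary hv).subset_compl_right

/-- A positive gap beyond the strictly nearest sites. -/
theorem Config.exists_ball_gap (S : Config d) (x : Space d) (a : ℝ) :
    ∃ b > a, ∀ w ∈ S.pts, dist x w < b → dist x w ≤ a := by
  have hfin := S.finite_inter (Metric.ball x (a + 1)) Metric.isBounded_ball
  have h : ∀ᶠ b in nhdsWithin a (Ioi a), ∀ w ∈ S.pts ∩ Metric.ball x (a + 1),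
      dist x w < b → dist x w ≤ a := by
    rw [Set.Finite.eventually_all hfin] 
    intro w hw
    by_cases hwa : dist x w ≤ a
    · exact Filter.Eventually.of_forall fun _ _ => hwa
    · filter_upwards [Ioo_mem_nhdsGT (not_le.1 hwa)] with b hb hlt
      exact absurd hb.2 hlt.not_gt
  obtain ⟨b, hb, hba⟩ := (h.and (Ioc_mem_nhdsGT (lt_add_one a))).exists
  refine ⟨b, hba.1, fun w hw hwb => hb w ⟨hw, ?_⟩ hwb⟩
  rw [Metric.mem_ball, dist_comm]
  exact hwb.trans_le hba.2

theorem exists_dense_rat_ball {D : Set (Space d)} (hD : Dense D) {B : Set (Space d)}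
    (hB : IsOpen B) {x : Space d} (hx : x ∈ B) {a b : ℝ} (hab : a < b) :
    ∃ y ∈ D, y ∈ B ∧ ∃ ρ : ℚ, Metric.closedBall x a ⊆ Metric.ball y ρ ∧
      Metric.ball y ρ ⊆ Metric.ball x b := by
  obtain ⟨y, hy, hyD⟩ := hD.inter_open_nonempty (B ∩ Metric.ball x ((b - a) / 4))
    (hB.inter Metric.isOpen_ball) ⟨x, hx, Metric.mem_ball_self (by linarith)⟩
  obtain ⟨ρ, h1, h2⟩ := exists_rat_btwn (show a + (b - a) / 4 < a + (b - a) / 2 by linarith)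
  have hxy := Metric.mem_ball.1 hy.2
  refine ⟨y, hyD, hy.1, ρ, Metric.closedBall_subset_ball' ?_, Metric.ball_subset_ball' ?_⟩
  · rw [dist_comm] at hxy; linarith
  · linarith

/-- An open connected set meets the Voronoi boundary iff two of its points (from a dense set) are
seen to have different nearest sites. -/
theorem Config.inter_voronoiBoundary_nonempty_iff (S : Config d) {D : Set (Space d)}
    (hD : Dense D) {B : Set (Space d)} (hB : IsOpen B) (hBc : IsPreconnected B) :
    (B ∩ voronoiBoundary S.pts).Nonempty ↔ ∃ x ∈ D ∩ B, ∃ y ∈ D ∩ B, ∃ ρ σ : ℚ,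
      (S.pts ∩ Metric.ball x ρ).Nonempty ∧ (S.pts ∩ Metric.ball y σ).Nonempty ∧
        S.pts ∩ (Metric.ball x ρ ∩ Metric.ball y σ) = ∅ := by
  constructor
  · rintro ⟨z, hzB, hz⟩
    obtain ⟨u, hu, hzu⟩ := mem_iUnion₂.1 hz
    have hzc := (isClosed_voronoiCell _ u).frontier_subset hzu
    obtain ⟨y, hyB, hy⟩ : ∃ y ∈ B, y ∉ voronoiCell S.pts u := by
      by_contra! h
      exact hzu.2 (mem_interior_iff_mem_nhds.2 (Filter.mem_of_superset (hB.mem_nhds hzB) h))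
    obtain ⟨v, hv, hyv⟩ := S.exists_mem_voronoiCell ⟨u, hu⟩ y
    have hvu : dist y v < dist y u := by
      by_contra! h
      exact hy fun w hw => h.trans (hyv w hw)
    obtain ⟨x, hxB, hx⟩ := exists_strictly_nearest hzc (hB.mem_nhds hzB)
    -- The ball around `x'` lies in the `b`-ball around `x`, where `u` is the only site; the ball
    -- around `y'` contains the closer site `v` but stays within distance `dist y u` of `y`, so it
    -- excludes `u`.
    obtain ⟨b, hb, hgap⟩ := S.exists_ball_gap x (dist x u)
    obtain ⟨x', hx'D, hx'B, ρ, hρ1, hρ2⟩ := exists_dense_rat_ball hD hB hxB hb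
    obtain ⟨y', hy'D, hy'B, σ, hσ1, hσ2⟩ := exists_dense_rat_ball hD hB hyB hvu
    refine ⟨x', ⟨hx'D, hx'B⟩, y', ⟨hy'D, hy'B⟩, ρ, σ, ⟨u, hu, hρ1 ?_⟩, ⟨v, hv, hσ1 ?_⟩, ?_⟩
    · simp [dist_comm]
    · simp [dist_comm]
    · rw [eq_empty_iff_forall_notMem]
      rintro w ⟨hw, hw1, hw2⟩
      have h1 := hgap w hw (by simpa [dist_comm] using hρ2 hw1)
      have hwu : w = u := by
        by_contra hne
        exact (hx w hw hne).not_ge h1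
      have h2 := Metric.mem_ball.1 (hσ2 hw2)
      rw [hwu, dist_comm] at h2
      exact lt_irrefl _ h2
  · rintro ⟨x, ⟨-, hx⟩, y, ⟨-, hy⟩, ρ, σ, ⟨a, ha, hax⟩, ⟨b, hb, hby⟩, hemp⟩
    obtain ⟨v, hv, hxv⟩ := S.exists_mem_voronoiCell ⟨a, ha⟩ x
    by_contra hne
    have hd : Disjoint B (voronoiBoundary S.pts) :=
      disjoint_iff_inter_eq_empty.2 (not_nonempty_iff_eq_empty.1 hne)
    -- If `B` missed the boundary, one site `v` would be nearest to both `x` and `y` and would lie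
    -- in both balls.
    have hyv := subset_voronoiCell_of_isPreconnected hBc hd hv hx hxv hy
    have h1 : v ∈ Metric.ball x ρ := by
      rw [Metric.mem_ball'] at *; exact (hxv a ha).trans_lt hax
    have h2 : v ∈ Metric.ball y σ := by
      rw [Metric.mem_ball'] at *; exact (hyv b hb).trans_lt hby
    exact (eq_empty_iff_forall_notMem.1 hemp) v ⟨hv, h1, h2⟩

/-- Triangle inequality: any other site is at distance more than `r` from a point of the ball. -/
theorem ball_subset_voronoiCell {S : Set (Space d)} {r : ℝ}
    (hsep : S.Pairwise fun x y => 2 * r ≤ dist x y) {v : Space d} (hv : v ∈ S) :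
    Metric.ball v r ⊆ voronoiCell S v := by
  intro x hx w hw
  by_cases h : v = w
  · rw [h]
  have h1 := hsep hv hw h
  have h2 := dist_triangle v x w
  rw [Metric.mem_ball] at hx
  rw [dist_comm v x] at h2
  linarith

/-- The small ball is `(1 - t) • y + t • ball v r`; both ingredients lie in the convex cell. -/
theorem ball_homothety_subset_voronoiCell {S : Set (Space d)} {r : ℝ}
    (hsep : S.Pairwise fun x y => 2 * r ≤ dist x y) {v y : Space d} (hv : v ∈ S)
    (hy : y ∈ voronoiCell S v) {t : ℝ} (h0 : 0 < t) (h1 : t ≤ 1) :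
    Metric.ball (AffineMap.homothety v (1 - t) y) (t * r) ⊆ voronoiCell S v := by
  intro p hp
  set q : Space d := v + t⁻¹ • (p - AffineMap.homothety v (1 - t) y) with hq
  have hqv : q ∈ voronoiCell S v := by
    apply ball_subset_voronoiCell hsep hv
    rw [Metric.mem_ball, dist_eq_norm, hq, add_sub_cancel_left, norm_smul, norm_inv,
      Real.norm_of_nonneg h0.le, inv_mul_lt_iff₀ h0, ← dist_eq_norm]
    exact hp
  have : p = (1 - t) • y + t • q := by
    rw [hq, smul_add, smul_inv_smul₀ h0.ne', AffineMap.homothety_apply]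
    simp only [vsub_eq_sub, vadd_eq_add]
    module
  rw [this]
  exact convex_voronoiCell S v hy hqv (by linarith) h0.le (by ring)

/-- Take the site `w` in the orthant of `x - v`. Then `‖x - v‖ ≤ ∑ i, |x i - v i| ≤ ⟪x - v, w - v⟫`,
and the half-space condition for `w` bounds the inner product by `‖w - v‖ ^ 2 / 2`. -/
theorem voronoiCell_subset_closedBall {S : Set (Space d)} {v : Space d} {D : ℝ}
    (h : ∀ s : Fin d → Bool, ∃ w ∈ S, dist w v ≤ D ∧
      ∀ i, 1 ≤ (if s i then 1 else -1) * (w i - v i)) :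
    voronoiCell S v ⊆ Metric.closedBall v (D ^ 2 / 2) := by
  intro x hx
  obtain ⟨w, hw, hD, hs⟩ := h fun i => decide (0 ≤ x i - v i)
  have h1 := mem_voronoiCell_iff_inner.1 hx w hw
  have h2 : 2 * ⟪x - v, w - v⟫_ℝ ≤ ‖w - v‖ ^ 2 := by
    rw [norm_sub_sq_real, inner_sub_left]
    have e : ⟪v, w - v⟫_ℝ = ⟪w, v⟫_ℝ - ‖v‖ ^ 2 := by
      rw [inner_sub_right, real_inner_self_eq_norm_sq, real_inner_comm]
    rw [e]; linarith
  have h3 : ∑ i, |x i - v i| ≤ ⟪x - v, w - v⟫_ℝ := by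
    rw [PiLp.inner_apply]
    refine Finset.sum_le_sum fun i _ => ?_
    have := hs i
    simp only [PiLp.sub_apply, RCLike.inner_apply, conj_trivial]
    by_cases hi : 0 ≤ x i - v i
    · simp only [hi, decide_true, if_true] at this
      rw [abs_of_nonneg hi]; nlinarith
    · simp only [hi, decide_false, Bool.false_eq_true, if_false] at this
      rw [abs_of_neg (not_le.1 hi)]; nlinarith
  have h4 : ‖x - v‖ ≤ ∑ i, |x i - v i| := by
    have h5 : ‖x - v‖ ^ 2 ≤ (∑ i, |x i - v i|) ^ 2 := by
      rw [EuclideanSpace.norm_sq_eq]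
      refine (Finset.sum_sq_le_sq_sum_of_nonneg fun i _ => norm_nonneg _).trans_eq ?_
      simp [Real.norm_eq_abs]
    exact (sq_le_sq₀ (norm_nonneg _) (Finset.sum_nonneg fun i _ => abs_nonneg _)).1 h5
  rw [Metric.mem_closedBall, dist_eq_norm]
  have h6 : ‖w - v‖ ^ 2 ≤ D ^ 2 := by
    rw [← dist_eq_norm]; gcongr
  linarith

end Geometry

/-! ### Counting unit cubes near the boundaries in a box -/

section Counting

variable {d : ℕ}

/-- The half-open cuboid with opposite vertices `a` and `b`. -/
def cuboid (a b : Fin d → ℝ) : Set (Space d) := {x | ∀ i, x i ∈ Ico (a i) (b i)}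

theorem cuboid_eq_preimage (a b : Fin d → ℝ) :
    cuboid a b = WithLp.ofLp ⁻¹' (univ.pi fun i => Ico (a i) (b i)) := by
  ext x; simp [cuboid]

theorem measurableSet_cuboid (a b : Fin d → ℝ) : MeasurableSet (cuboid a b) := by
  rw [cuboid_eq_preimage]
  exact (PiLp.volume_preserving_ofLp (Fin d)).measurable (MeasurableSet.univ_pi fun _ => measurableSet_Ico)

theorem volume_cuboid (a b : Fin d → ℝ) :
    volume (cuboid a b) = ∏ i, ENNReal.ofReal (b i - a i) := by
  rw [cuboid_eq_preimage, (PiLp.volume_preserving_ofLp (Fin d)).measure_preimage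
    (MeasurableSet.univ_pi fun _ => measurableSet_Ico).nullMeasurableSet, Real.volume_pi_Ico]

/-- The point of the lattice `ℤ^d` with given coordinates. -/
noncomputable def latticePt (z : Fin d → ℤ) : Space d := WithLp.toLp 2 fun i => (z i : ℝ)

@[simp] theorem latticePt_apply (z : Fin d → ℤ) (i : Fin d) : latticePt z i = z i := rfl

/-- The half-open unit cube with lower vertex `z`. -/
def unitCube (z : Fin d → ℤ) : Set (Space d) := cuboid (fun i => (z i : ℝ)) fun i => z i + 1

theorem volume_unitCube (z : Fin d → ℤ) : volume (unitCube z) = 1 := by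
  simp [unitCube, volume_cuboid]

theorem pairwise_disjoint_unitCube :
    Pairwise (Function.onFun Disjoint (unitCube : (Fin d → ℤ) → Set (Space d))) := by
  intro z z' hne
  rw [Function.onFun, Set.disjoint_left]
  intro x hx hx'
  refine hne (funext fun i => ?_)
  rw [← Int.floor_eq_iff.2 (hx i), Int.floor_eq_iff.2 (hx' i)]

theorem volume_biUnion_unitCube (F : Finset (Fin d → ℤ)) :
    volume (⋃ z ∈ F, unitCube z) = F.card := by
  rw [measure_biUnion_finset (pairwise_disjoint_unitCube.set_pairwise _)
    fun z _ => measurableSet_cuboid _ _]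
  simp [volume_unitCube]

theorem dist_latticePt_le {z : Fin d → ℤ} {x : Space d} (hx : x ∈ unitCube z) :
    dist x (latticePt z) ≤ √d := by
  rw [EuclideanSpace.dist_eq]
  refine Real.sqrt_le_sqrt ?_
  calc ∑ i, dist (x i) (latticePt z i) ^ 2 ≤ ∑ _i : Fin d, (1 : ℝ) := by
        refine Finset.sum_le_sum fun i _ => ?_
        have := hx i
        rw [Real.dist_eq, sq_abs, latticePt_apply]
        nlinarith [this.1, this.2]
    _ = d := by simp

/-- The lattice points of `[L, n - L)^d`. -/
noncomputable def latticeBox (d n L : ℕ) : Finset (Fin d → ℤ) :=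
  Fintype.piFinset fun _ => Finset.Ico (L : ℤ) (n - L)

theorem card_latticeBox (d : ℕ) {n L : ℕ} (h : 2 * L ≤ n) :
    (latticeBox d n L).card = (n - 2 * L) ^ d := by
  rw [latticeBox, Fintype.card_piFinset]
  simp only [Int.card_Ico, Finset.prod_const, Finset.card_univ, Fintype.card_fin]
  congr 1
  omega

theorem voronoiCell_contraction_subset {S : Set (Space d)} {r : ℝ}
    (hr : 0 < r) (hsep : S.Pairwise fun x y => 2 * r ≤ dist x y) {v : Space d} (hv : v ∈ S)
    {t : ℝ} (h0 : 0 < t) (h1 : t ≤ 1) :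
    AffineMap.homothety v (1 - t) '' voronoiCell S v ⊆ interior (voronoiCell S v) := by
  rintro _ ⟨y, hy, rfl⟩
  exact mem_interior.2 ⟨_, ball_homothety_subset_voronoiCell hsep hv hy h0 h1, Metric.isOpen_ball,
    Metric.mem_ball_self (mul_pos h0 hr)⟩

/-- Few unit cubes are close to the boundaries of large Voronoi cells: comparison of the volumes of
the cells with the volumes of slightly contracted cells. -/
theorem Config.card_near_boundary_add_le (S : Config d) (hS : S.pts.Nonempty) {r t R : ℝ}
    (hr : 0 < r) (hsep : S.pts.Pairwise fun x y => 2 * r ≤ dist x y) (h0 : 0 < t) (h1 : t ≤ 1)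
    (htr : R + √d ≤ t * r) (n L : ℕ) (F G : Finset (Fin d → ℤ))
    (hF : ∀ z ∈ F, z ∈ latticeBox d n 0 ∧
      (Metric.ball (latticePt z) R ∩ voronoiBoundary S.pts).Nonempty)
    (hG : ∀ z ∈ G, z ∈ latticeBox d n L ∧ ∀ v ∈ S.pts, (unitCube z ∩ voronoiCell S.pts v).Nonempty →
      voronoiCell S.pts v ⊆ Metric.ball (latticePt z) L) :
    (F.card : ℝ≥0∞) + ENNReal.ofReal ((1 - t) ^ d) * G.card ≤ (n : ℝ≥0∞) ^ d := by
  set box : Set (Space d) := cuboid (fun _ => 0) fun _ => (n : ℝ) with hbox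
  have hvol : volume box = (n : ℝ≥0∞) ^ d := by
    simp [hbox, volume_cuboid]
  have hbdd : Bornology.IsBounded box := by
    have : box ⊆ ⋃ z ∈ latticeBox d n 0, unitCube z := by
      intro x hx
      refine mem_iUnion₂.2 ⟨fun i => ⌊x i⌋, ?_, fun i => ⟨Int.floor_le _, Int.lt_floor_add_one _⟩⟩
      rw [latticeBox, Fintype.mem_piFinset]
      intro i
      simp only [Nat.cast_zero, sub_zero, Finset.mem_Ico]
      exact ⟨Int.floor_nonneg.2 (hx i).1, Int.floor_lt.2 (by simpa using (hx i).2)⟩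
    refine Bornology.IsBounded.subset ?_ this
    refine (Bornology.isBounded_biUnion_finset _).2 fun z _ => ?_
    exact Metric.isBounded_closedBall.subset fun x hx => dist_latticePt_le hx
  -- Only cells lying entirely in the box are used, so that their contractions are compact and fit
  -- into its volume.
  set I : Set (Space d) := {v | v ∈ S.pts ∧ voronoiCell S.pts v ⊆ box} with hI
  have hself : ∀ v, v ∈ voronoiCell S.pts v := fun v w _ => by simp
  have hIfin : I.Finite := (S.finite_inter box hbdd).subset fun v hv => ⟨hv.1, hv.2 (hself v)⟩
  set T : Space d → Set (Space d) := fun v =>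
    AffineMap.homothety v (1 - t) '' voronoiCell S.pts v with hT
  have hTint : ∀ v ∈ S.pts, T v ⊆ interior (voronoiCell S.pts v) := fun v hv =>
    voronoiCell_contraction_subset hr hsep hv h0 h1
  have hTmeas : ∀ v ∈ I, MeasurableSet (T v) := fun v hv => by
    have hc : IsCompact (voronoiCell S.pts v) :=
      Metric.isCompact_of_isClosed_isBounded (isClosed_voronoiCell _ v) (hbdd.subset hv.2)
    exact (hc.image (AffineMap.homothety_continuous v (1 - t))).measurableSet
  have hTdisj : I.PairwiseDisjoint T := by
    intro v hv u hu hne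
    rw [Function.onFun, Set.disjoint_left]
    intro x hx hx'
    exact hne (eq_of_mem_interior_voronoiCell hv.1 hu.1 (hTint v hv.1 hx)
      (interior_subset (hTint u hu.1 hx')))
  have hTvol : ∀ v, volume (T v) =
      ENNReal.ofReal ((1 - t) ^ d) * volume (voronoiCell S.pts v) := fun v => by
    rw [hT, Measure.addHaar_image_homothety]
    simp [abs_of_nonneg (sub_nonneg.2 h1)]
  -- The cubes of `G` are covered by cells of `I`: every cell meeting such a cube stays within `L`
  -- of its lattice point, hence in the box.
  have hGvol : ENNReal.ofReal ((1 - t) ^ d) * G.card ≤ volume (⋃ v ∈ I, T v) := by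
    rw [measure_biUnion hIfin.countable hTdisj hTmeas]
    simp_rw [hTvol]
    rw [ENNReal.tsum_mul_left, ← volume_biUnion_unitCube G]
    gcongr
    refine (measure_mono (iUnion₂_subset fun z hz => ?_)).trans
      (measure_biUnion_le volume hIfin.countable _)
    intro x hx
    obtain ⟨v, hv, hxv⟩ := S.exists_mem_voronoiCell hS x
    obtain ⟨hzb, hzG⟩ := hG z hz
    refine mem_iUnion₂.2 ⟨v, ⟨hv, fun y hy => fun i => ?_⟩, hxv⟩
    have h2 := hzG v hv ⟨x, hx, hxv⟩ hy
    rw [Metric.mem_ball, dist_eq_norm] at h2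
    have h3 := ((PiLp.norm_apply_le (y - latticePt z) i).trans_lt h2)
    rw [PiLp.sub_apply, Real.norm_eq_abs, abs_lt, latticePt_apply] at h3
    rw [latticeBox, Fintype.mem_piFinset] at hzb
    obtain ⟨h4, h5⟩ := Finset.mem_Ico.1 (hzb i)
    have h6 : (z i : ℝ) + 1 ≤ n - L := by exact_mod_cast h5
    have h7 : (L : ℝ) ≤ z i := by exact_mod_cast h4
    exact ⟨by linarith, by linarith⟩
  -- If a cube of `F` met a contracted cell, a boundary point would lie within `R + √d ≤ t * r` of a
  -- contracted point, inside the margin and so in the interior of the cell.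
  have hdisj : Disjoint (⋃ z ∈ F, unitCube z) (⋃ v ∈ I, T v) := by
    simp only [disjoint_iUnion_left, disjoint_iUnion_right]
    intro v hv z hz
    rw [Set.disjoint_left]
    rintro x hxz ⟨y, hy, rfl⟩
    obtain ⟨p, hp, hpb⟩ := (hF z hz).2
    have hsub := ball_homothety_subset_voronoiCell hsep hv.1 hy h0 h1
    have hpball : p ∈ Metric.ball (AffineMap.homothety v (1 - t) y) (t * r) := by
      have h2 := dist_latticePt_le hxz
      rw [Metric.mem_ball] at hp ⊢
      have h3 := dist_triangle_right p (AffineMap.homothety v (1 - t) y) (latticePt z)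
      linarith
    exact Set.disjoint_left.1 (disjoint_interior_voronoiBoundary hv.1)
      (mem_interior.2 ⟨_, hsub, Metric.isOpen_ball, hpball⟩) hpb
  calc (F.card : ℝ≥0∞) + ENNReal.ofReal ((1 - t) ^ d) * G.card
      ≤ volume (⋃ z ∈ F, unitCube z) + volume (⋃ v ∈ I, T v) := by
        rw [volume_biUnion_unitCube]; gcongr
    _ = volume ((⋃ z ∈ F, unitCube z) ∪ ⋃ v ∈ I, T v) :=
        (measure_union hdisj (hIfin.measurableSet_biUnion hTmeas)).symm
    _ ≤ volume box := by
        refine measure_mono (union_subset (iUnion₂_subset fun z hz x hx i => ?_)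
          (iUnion₂_subset fun v hv => ?_))
        · have hzb := (hF z hz).1
          rw [latticeBox, Fintype.mem_piFinset] at hzb
          obtain ⟨h4, h5⟩ := Finset.mem_Ico.1 (hzb i)
          have h6 : (z i : ℝ) + 1 ≤ n := by
            have : z i + 1 ≤ n := by simpa using h5
            exact_mod_cast this
          have h7 : (0 : ℝ) ≤ z i := by exact_mod_cast h4
          exact ⟨h7.trans (hx i).1, (hx i).2.trans_le h6⟩
        · exact ((hTint v hv.1).trans interior_subset).trans hv.2
    _ = (n : ℝ≥0∞) ^ d := hvol

end Counting

/-! ### Equivariance and measurability of Voronoi boundaries -/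

section Measurability

variable {d : ℕ}

theorem image_voronoiCell (γ : Space d ≃ᵢ Space d) (S : Set (Space d)) (v : Space d) :
    γ '' voronoiCell S v = voronoiCell (γ '' S) (γ v) := by
  ext x
  obtain ⟨y, rfl⟩ := γ.surjective x
  simp [voronoiCell, γ.isometry.dist_eq]

theorem voronoiBoundary_image (γ : Space d ≃ᵢ Space d) (S : Set (Space d)) :
    voronoiBoundary (γ '' S) = γ '' voronoiBoundary S := by
  have h : ∀ v, frontier (voronoiCell (γ '' S) (γ v)) = γ '' frontier (voronoiCell S v) := fun v => by
    rw [← image_voronoiCell]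
    exact (γ.toHomeomorph.image_frontier _).symm
  simp only [voronoiBoundary, biUnion_image, image_iUnion, h]

theorem Config.measurableSet_hit {B : Set (Space d)} (hB : MeasurableSet B) :
    MeasurableSet {S : Config d | (S.pts ∩ B).Nonempty} := by
  have : {S : Config d | (S.pts ∩ B).Nonempty} = Config.count B ⁻¹' {0}ᶜ := by
    ext S
    simp [Config.count, nonempty_iff_ne_empty]
  rw [this]
  exact Config.measurable_count hB (measurableSet_singleton _).compl

theorem Config.measurableSet_nonempty : MeasurableSet {S : Config d | S.pts.Nonempty} := by
  simpa using Config.measurableSet_hit (d := d) MeasurableSet.univ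

/-- The nearest-site criterion over a countable dense set and rational radii turns the event into
countably many hit events for balls. -/
theorem Config.measurableSet_hit_voronoiBoundary {B : Set (Space d)} (hB : IsOpen B)
    (hBc : IsPreconnected B) :
    MeasurableSet {S : Config d | (B ∩ voronoiBoundary S.pts).Nonempty} := by
  obtain ⟨D, hDc, hD⟩ := TopologicalSpace.exists_countable_dense (Space d)
  have hDB : (D ∩ B).Countable := hDc.mono inter_subset_left
  simp_rw [fun S : Config d => S.inter_voronoiBoundary_nonempty_iff hD hB hBc,
    ← not_nonempty_iff_eq_empty]
  have : {S : Config d | ∃ x ∈ D ∩ B, ∃ y ∈ D ∩ B, ∃ ρ σ : ℚ,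
      (S.pts ∩ Metric.ball x ρ).Nonempty ∧ (S.pts ∩ Metric.ball y σ).Nonempty ∧
        ¬ (S.pts ∩ (Metric.ball x ρ ∩ Metric.ball y σ)).Nonempty} =
      ⋃ x ∈ D ∩ B, ⋃ y ∈ D ∩ B, ⋃ ρ : ℚ, ⋃ σ : ℚ,
        {S : Config d | (S.pts ∩ Metric.ball x ρ).Nonempty} ∩
          ({S : Config d | (S.pts ∩ Metric.ball y σ).Nonempty} ∩
            {S : Config d | (S.pts ∩ (Metric.ball x ρ ∩ Metric.ball y σ)).Nonempty}ᶜ) := by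
    ext S
    simp only [mem_ofPred_eq, mem_iUnion, exists_prop, mem_inter_iff, mem_compl_iff]
  rw [this]
  refine .biUnion hDB fun x _ => .biUnion hDB fun y _ => .iUnion fun ρ => .iUnion fun σ => ?_
  exact (measurableSet_hit measurableSet_ball).inter
    ((measurableSet_hit measurableSet_ball).inter
      (measurableSet_hit (measurableSet_ball.inter measurableSet_ball)).compl)

end Measurability

/-! ### Stationarity, bounded cells and the boundary estimate -/

section Stationary

variable {d : ℕ} {Ω : Type*} [MeasurableSpace Ω]

/-- The law of the random configuration `X` is invariant under translations. -/
def IsStationary (μ : Measure Ω) (X : Ω → Config d) : Prop :=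
  ∀ (a : Space d) (E : Set (Config d)), MeasurableSet E →
    μ {ω | (X ω).map (IsometryEquiv.addRight a) ∈ E} = μ {ω | X ω ∈ E}

/-- The closed orthant of points whose coordinates have signs `s` and absolute value at
least `c`. -/
def orthant (s : Fin d → Bool) (c : ℝ) : Set (Space d) :=
  {w | ∀ i, c ≤ (if s i then 1 else -1) * w i}

theorem isClosed_orthant (s : Fin d → Bool) (c : ℝ) : IsClosed (orthant s c) := by
  simp only [orthant, ofPred_forall]
  exact isClosed_iInter fun i => isClosed_le (by fun_prop) (by fun_prop)

theorem hit_map_iff (γ : Space d ≃ᵢ Space d) (S : Config d) (B : Set (Space d)) :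
    ((S.map γ).pts ∩ B).Nonempty ↔ (S.pts ∩ γ ⁻¹' B).Nonempty :=
  image_inter_nonempty_iff

/-- The orthants with offset `c - n` are translates of one another and increase to the whole space,
so the hit events have constant probability and their union is nonemptiness. Nested events of equal
finite measure agree almost everywhere. -/
theorem IsStationary.ae_hit_orthant {μ : Measure Ω} [IsFiniteMeasure μ] {X : Ω → Config d}
    (hX : AEMeasurable X μ) (hs : IsStationary μ X) (s : Fin d → Bool) (c : ℝ) :
    ∀ᵐ ω ∂μ, (X ω).pts.Nonempty → ((X ω).pts ∩ orthant s c).Nonempty := by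
  set H : ℝ → Set Ω := fun c => {ω | ((X ω).pts ∩ orthant s c).Nonempty} with hH
  have hshift : ∀ n : ℕ, μ (H (c - n)) = μ (H c) := fun n => by
    refine Eq.trans ?_ (hs (WithLp.toLp 2 fun i => (if s i then 1 else -1) * (n : ℝ))
      {S | (S.pts ∩ orthant s c).Nonempty}
      (Config.measurableSet_hit (isClosed_orthant s c).measurableSet))
    congr 1
    ext ω
    simp only [hH, mem_ofPred_eq, hit_map_iff]
    suffices h : orthant s (c - n) = (IsometryEquiv.addRight (WithLp.toLp 2 fun i =>
        (if s i then 1 else -1) * (n : ℝ)) : Space d ≃ᵢ Space d) ⁻¹' orthant s c by rw [h]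
    ext w
    simp only [orthant, mem_ofPred_eq, mem_preimage, IsometryEquiv.addRight_apply, PiLp.add_apply]
    refine forall_congr' fun i => ?_
    split_ifs <;> constructor <;> intro h <;> linarith
  have hmono : Monotone fun n : ℕ => H (c - n) := by
    rintro m n hmn ω ⟨w, hw, hwo⟩
    have : (m : ℝ) ≤ n := by exact_mod_cast hmn
    exact ⟨w, hw, fun i => le_trans (by linarith) (hwo i)⟩
  have hunion : ⋃ n : ℕ, H (c - n) = {ω | (X ω).pts.Nonempty} := by
    ext ω
    simp only [mem_iUnion, mem_ofPred_eq, hH]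
    refine ⟨fun ⟨n, w, hw, _⟩ => ⟨w, hw⟩, fun ⟨w, hw⟩ => ?_⟩
    obtain ⟨n, hn⟩ := exists_nat_ge (c + ‖w‖)
    refine ⟨n, w, hw, fun i => ?_⟩
    have h1 := abs_le.1 (PiLp.norm_apply_le w i)
    split_ifs <;> linarith
  have hmeas : μ {ω | (X ω).pts.Nonempty} = μ (H c) := by
    have h1 := tendsto_measure_iUnion_atTop (μ := μ) hmono
    rw [hunion] at h1
    simp_rw [Function.comp_def, hshift] at h1
    exact tendsto_nhds_unique h1 tendsto_const_nhds
  have hsub : H c ⊆ {ω | (X ω).pts.Nonempty} := fun ω ⟨w, hw, _⟩ => ⟨w, hw⟩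
  have hnull : NullMeasurableSet (H c) μ := hX.nullMeasurableSet_preimage
    (Config.measurableSet_hit (isClosed_orthant s c).measurableSet)
  have := ae_eq_of_subset_of_measure_ge hsub hmeas.le hnull (measure_ne_top _ _)
  filter_upwards [this.mem_iff] with ω hω h
  exact hω.2 h

/-- The points of `S` surround the point `p` at scale `L`. -/
def SurroundedAt (S : Set (Space d)) (p : Space d) (L : ℕ) : Prop :=
  ∃ l ≤ L, (S ∩ Metric.ball p l).Nonempty ∧ ∀ s : Fin d → Bool,
    (S ∩ (Metric.ball p L ∩ {w | w - p ∈ orthant s (l + 2 * √d + 1)})).Nonempty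

theorem surroundedAt_map_iff (S : Config d) (p a : Space d) (L : ℕ) :
    SurroundedAt (S.map (IsometryEquiv.addRight a)).pts (p + a) L ↔ SurroundedAt S.pts p L := by
  simp only [SurroundedAt, hit_map_iff, preimage_inter]
  have h1 : ∀ r : ℝ, (IsometryEquiv.addRight a : Space d ≃ᵢ Space d) ⁻¹' Metric.ball (p + a) r =
      Metric.ball p r := fun r => by ext; simp
  have h2 : ∀ O : Set (Space d), (IsometryEquiv.addRight a : Space d ≃ᵢ Space d) ⁻¹'
      {w | w - (p + a) ∈ O} = {w | w - p ∈ O} := fun O => by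
    ext; simp
  simp_rw [h1, h2]

theorem measurableSet_surroundedAt (p : Space d) (L : ℕ) :
    MeasurableSet {S : Config d | SurroundedAt S.pts p L} := by
  have : {S : Config d | SurroundedAt S.pts p L} = ⋃ l ∈ Iic L,
      {S : Config d | (S.pts ∩ Metric.ball p l).Nonempty} ∩ ⋂ s : Fin d → Bool,
        {S : Config d | (S.pts ∩ (Metric.ball p L ∩
          {w | w - p ∈ orthant s (l + 2 * √d + 1)})).Nonempty} := by
    ext S
    simp only [SurroundedAt, mem_ofPred_eq, mem_iUnion, mem_inter_iff, mem_iInter, mem_Iic,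
      exists_prop]
  rw [this]
  refine .biUnion (to_countable _) fun l _ => (Config.measurableSet_hit measurableSet_ball).inter
    (.iInter fun s => Config.measurableSet_hit (measurableSet_ball.inter ?_))
  exact ((isClosed_orthant s _).preimage (by fun_prop : Continuous fun w : Space d => w - p)).measurableSet

theorem surroundedAt_mono (S : Set (Space d)) (p : Space d) : Monotone (SurroundedAt S p) := by
  rintro L L' h ⟨l, hl, hb, ho⟩
  refine ⟨l, hl.trans h, hb, fun s => (ho s).mono ?_⟩
  gcongr

/-- Voronoi cells that come close to a surrounded point are uniformly bounded. -/
theorem exists_voronoiCell_subset_ball_of_surroundedAt (d L : ℕ) : ∃ L' : ℕ,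
    ∀ (S : Set (Space d)) (p : Space d), SurroundedAt S p L → ∀ v ∈ S, ∀ x ∈ voronoiCell S v,
      dist x p ≤ √d → voronoiCell S v ⊆ Metric.ball p L' := by
  -- The first summand is the radius of the cell about its site, from `D = 2 * L + 2 * √d`; the
  -- second bounds the distance from that site to `p`.
  obtain ⟨L', hL'⟩ := exists_nat_gt ((2 * L + 2 * √d) ^ 2 / 2 + (L + 2 * √d))
  refine ⟨L', fun S p ⟨l, hl, ⟨a, ha, hap⟩, ho⟩ v hv x hx hxp => ?_⟩
  have hlL : (l : ℝ) ≤ L := by exact_mod_cast hl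
  rw [Metric.mem_ball] at hap
  -- As `v` is this close to `p`, the offset `l + 2 * √d + 1` leaves a surplus of `1` in each
  -- coordinate relative to `v`.
  have hvp : dist v p ≤ l + 2 * √d := by
    have h1 := hx a ha
    have h2 := dist_triangle x p a
    have h3 := dist_triangle v x p
    rw [dist_comm v x] at h3
    rw [dist_comm p a] at h2
    linarith
  refine (voronoiCell_subset_closedBall (D := 2 * L + 2 * √d) fun s => ?_).trans
    (Metric.closedBall_subset_ball' (by linarith))
  obtain ⟨w, hw, hwb, hwo⟩ := ho s
  refine ⟨w, hw, ?_, fun i => ?_⟩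
  · have h1 := dist_triangle_right w v p
    rw [Metric.mem_ball] at hwb
    linarith
  · have h1 := hwo i
    have h2 := abs_le.1 ((PiLp.norm_apply_le (v - p) i).trans ((dist_eq_norm v p).symm.trans_le hvp))
    simp only [PiLp.sub_apply] at h1 h2
    split_ifs at h1 ⊢ <;> linarith

theorem IsStationary.ae_surroundedAt {μ : Measure Ω} [IsFiniteMeasure μ] {X : Ω → Config d}
    (hX : AEMeasurable X μ) (hs : IsStationary μ X) :
    ∀ᵐ ω ∂μ, (X ω).pts.Nonempty → ∀ p, ∃ L, SurroundedAt (X ω).pts p L := by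
  have h : ∀ᵐ ω ∂μ, ∀ (s : Fin d → Bool) (c : ℕ), (X ω).pts.Nonempty →
      ((X ω).pts ∩ orthant s c).Nonempty :=
    ae_all_iff.2 fun s => ae_all_iff.2 fun c => hs.ae_hit_orthant hX s c
  filter_upwards [h] with ω hω hne p
  obtain ⟨a, ha⟩ := id hne
  obtain ⟨l, hl⟩ := exists_nat_gt (dist a p)
  -- The orthants hit are based at the origin; `‖p‖` compensates for moving the base to `p`.
  obtain ⟨c, hc⟩ := exists_nat_ge (l + 2 * √d + 1 + ‖p‖)
  choose w hw using fun s => hω s c hne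
  obtain ⟨L, hL⟩ := exists_nat_gt (∑ s, dist (w s) p)
  refine ⟨max l L, l, le_max_left _ _, ⟨a, ha, hl⟩, fun s => ⟨w s, (hw s).1, ?_, fun i => ?_⟩⟩
  · rw [Metric.mem_ball]
    calc dist (w s) p ≤ ∑ s, dist (w s) p :=
          Finset.single_le_sum (f := fun s => dist (w s) p) (fun _ _ => dist_nonneg)
            (Finset.mem_univ s)
      _ < L := hL
      _ ≤ (max l L : ℕ) := by exact_mod_cast le_max_right _ _
  · have h1 := (hw s).2 i
    have h2 := abs_le.1 (PiLp.norm_apply_le p i)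
    simp only [PiLp.sub_apply]
    split_ifs at h1 ⊢ <;> linarith

theorem IsStationary.measure_surroundedAt {μ : Measure Ω} {X : Ω → Config d}
    (hs : IsStationary μ X) (p : Space d) (L : ℕ) :
    μ {ω | SurroundedAt (X ω).pts p L} = μ {ω | SurroundedAt (X ω).pts 0 L} := by
  refine (hs p {S | SurroundedAt S.pts p L} (measurableSet_surroundedAt p L)).symm.trans ?_
  congr 1
  ext ω
  have := surroundedAt_map_iff (X ω) 0 p L
  rw [zero_add] at this
  exact this

/-- The open `R`-ball around `p` meets the Voronoi boundary. -/
def NearBoundary (S : Set (Space d)) (p : Space d) (R : ℝ) : Prop :=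
  (Metric.ball p R ∩ voronoiBoundary S).Nonempty

theorem measurableSet_nearBoundary (p : Space d) (R : ℝ) :
    MeasurableSet {S : Config d | NearBoundary S.pts p R} :=
  Config.measurableSet_hit_voronoiBoundary Metric.isOpen_ball (convex_ball p R).isPreconnected

theorem IsStationary.measure_nearBoundary {μ : Measure Ω} {X : Ω → Config d}
    (hs : IsStationary μ X) (p : Space d) (R : ℝ) :
    μ {ω | NearBoundary (X ω).pts p R} = μ {ω | NearBoundary (X ω).pts 0 R} := by
  refine (hs p {S | NearBoundary S.pts p R} (measurableSet_nearBoundary p R)).symm.trans ?_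
  congr 1
  ext ω
  have h1 : (IsometryEquiv.addRight p : Space d ≃ᵢ Space d) ⁻¹' Metric.ball p R =
      Metric.ball 0 R := by ext; simp
  simp only [mem_ofPred_eq, NearBoundary, Config.map, voronoiBoundary_image]
  rw [inter_comm (Metric.ball p R), image_inter_nonempty_iff, h1, inter_comm]

/-- The averaged form of `Config.card_near_boundary_add_le`. -/
theorem IsStationary.measure_nearBoundary_add_le_of_box {μ : Measure Ω} [IsFiniteMeasure μ]
    {X : Ω → Config d} (hX : AEMeasurable X μ) (hs : IsStationary μ X) {r t R : ℝ} (hr : 0 < r)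
    (hsep : ∀ᵐ ω ∂μ, (X ω).pts.Pairwise fun x y => 2 * r ≤ dist x y) (h0 : 0 < t) (h1 : t ≤ 1)
    (htr : R + √d ≤ t * r) (L : ℕ) : ∃ L' : ℕ, ∀ n, 2 * L' ≤ n →
      (n : ℝ≥0∞) ^ d * μ {ω | NearBoundary (X ω).pts 0 R} +
        ENNReal.ofReal ((1 - t) ^ d) *
          (((n - 2 * L' : ℕ) : ℝ≥0∞) ^ d * μ {ω | SurroundedAt (X ω).pts 0 L}) ≤
      (n : ℝ≥0∞) ^ d * μ {ω | (X ω).pts.Nonempty} := by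
  classical
  obtain ⟨L', hL'⟩ := exists_voronoiCell_subset_ball_of_surroundedAt d L
  refine ⟨L', fun n hn => ?_⟩
  set N : (Fin d → ℤ) → Set Ω := fun z => {ω | NearBoundary (X ω).pts (latticePt z) R} with hN
  set G : (Fin d → ℤ) → Set Ω := fun z => {ω | SurroundedAt (X ω).pts (latticePt z) L} with hG
  have hNm : ∀ z, NullMeasurableSet (N z) μ := fun z =>
    hX.nullMeasurableSet_preimage (measurableSet_nearBoundary _ _)
  have hGm : ∀ z, NullMeasurableSet (G z) μ := fun z =>
    hX.nullMeasurableSet_preimage (measurableSet_surroundedAt _ _)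
  have hEm : NullMeasurableSet {ω | (X ω).pts.Nonempty} μ :=
    hX.nullMeasurableSet_preimage Config.measurableSet_nonempty
  have hNi : ∀ z, ∫⁻ ω, (N z).indicator 1 ω ∂μ = μ {ω | NearBoundary (X ω).pts 0 R} := fun z => by
    rw [lintegral_indicator_one₀ (hNm z), hs.measure_nearBoundary]
  have hGi : ∀ z, ∫⁻ ω, (G z).indicator 1 ω ∂μ = μ {ω | SurroundedAt (X ω).pts 0 L} := fun z => by
    rw [lintegral_indicator_one₀ (hGm z), hs.measure_surroundedAt]
  -- The deterministic count holds for each nonempty configuration; without points both sides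
  -- vanish.
  have key : ∀ᵐ ω ∂μ, ∑ z ∈ latticeBox d n 0, (N z).indicator (1 : Ω → ℝ≥0∞) ω +
      ENNReal.ofReal ((1 - t) ^ d) * ∑ z ∈ latticeBox d n L', (G z).indicator 1 ω ≤
        (n : ℝ≥0∞) ^ d * {ω | (X ω).pts.Nonempty}.indicator 1 ω := by
    filter_upwards [hsep] with ω hω
    by_cases hne : (X ω).pts.Nonempty
    · have hne' : ω ∈ {ω | (X ω).pts.Nonempty} := hne
      rw [indicator_of_mem hne']
      simp only [indicator_apply, Pi.one_apply, Finset.sum_boole, mul_one]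
      refine (X ω).card_near_boundary_add_le hne hr hω h0 h1 htr n L' _ _ (fun z hz => ?_)
        fun z hz => ?_
      · exact Finset.mem_filter.1 hz
      · obtain ⟨hz1, hz2⟩ := Finset.mem_filter.1 hz
        refine ⟨hz1, fun v hv ⟨x, hxz, hxv⟩ => ?_⟩
        exact hL' _ _ hz2 v hv x hxv (dist_latticePt_le hxz)
    · have hN0 : ∀ z, ω ∉ N z := fun z ⟨x, _, hx⟩ => by
        obtain ⟨v, hv, _⟩ := mem_iUnion₂.1 hx
        exact hne ⟨v, hv⟩
      have hG0 : ∀ z, ω ∉ G z := fun z ⟨_, _, ⟨v, hv, _⟩, _⟩ => hne ⟨v, hv⟩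
      simp [hN0, hG0]
  have hint := lintegral_mono_ae key
  have hNa : ∀ z, AEMeasurable ((N z).indicator (1 : Ω → ℝ≥0∞)) μ := fun z =>
    aemeasurable_const.indicator₀ (hNm z)
  have hGa : ∀ z, AEMeasurable ((G z).indicator (1 : Ω → ℝ≥0∞)) μ := fun z =>
    aemeasurable_const.indicator₀ (hGm z)
  have hEa : AEMeasurable ({ω | (X ω).pts.Nonempty}.indicator (1 : Ω → ℝ≥0∞)) μ :=
    aemeasurable_const.indicator₀ hEm
  rw [lintegral_add_left' (Finset.aemeasurable_fun_sum _ fun z _ => hNa z),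
    lintegral_finsetSum' _ fun z _ => hNa z,
    lintegral_const_mul'' _ (Finset.aemeasurable_fun_sum _ fun z _ => hGa z),
    lintegral_finsetSum' _ fun z _ => hGa z,
    lintegral_const_mul'' _ hEa,
    lintegral_indicator_one₀ hEm] at hint
  simp_rw [hNi, hGi] at hint
  rw [Finset.sum_const, Finset.sum_const, card_latticeBox d hn, card_latticeBox d (by omega)] at hint
  simpa using hint

/-- Divide the box estimate by `n ^ d` and let `n → ∞`, which removes the margin `L'`; then let `L →
∞`, when being surrounded exhausts nonemptiness. -/
theorem IsStationary.measure_nearBoundary_add_le {μ : Measure Ω} [IsFiniteMeasure μ]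
    {X : Ω → Config d} (hX : AEMeasurable X μ) (hs : IsStationary μ X) {r t R : ℝ} (hr : 0 < r)
    (hsep : ∀ᵐ ω ∂μ, (X ω).pts.Pairwise fun x y => 2 * r ≤ dist x y) (h0 : 0 < t) (h1 : t ≤ 1)
    (htr : R + √d ≤ t * r) :
    μ.real {ω | NearBoundary (X ω).pts 0 R} + (1 - t) ^ d * μ.real {ω | (X ω).pts.Nonempty} ≤
      μ.real {ω | (X ω).pts.Nonempty} := by
  have hc : 0 ≤ (1 - t) ^ d := pow_nonneg (sub_nonneg.2 h1) d
  have hL : ∀ L, μ.real {ω | NearBoundary (X ω).pts 0 R} +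
      (1 - t) ^ d * μ.real {ω | SurroundedAt (X ω).pts 0 L} ≤ μ.real {ω | (X ω).pts.Nonempty} := by
    intro L
    obtain ⟨L', hL'⟩ := hs.measure_nearBoundary_add_le_of_box hX hr hsep h0 h1 htr L
    have hlim : Filter.Tendsto (fun n : ℕ => μ.real {ω | NearBoundary (X ω).pts 0 R} +
        (1 - t) ^ d * ((1 - 2 * L' / (n : ℝ)) ^ d * μ.real {ω | SurroundedAt (X ω).pts 0 L}))
        Filter.atTop (nhds (μ.real {ω | NearBoundary (X ω).pts 0 R} +
        (1 - t) ^ d * ((1 - 0) ^ d * μ.real {ω | SurroundedAt (X ω).pts 0 L}))) := by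
      have := tendsto_const_div_atTop_nhds_zero_nat (2 * L' : ℝ)
      exact ((((this.const_sub 1).pow d).mul_const _).const_mul _).const_add _
    rw [sub_zero, one_pow, one_mul] at hlim
    refine le_of_tendsto hlim ?_
    filter_upwards [Filter.eventually_ge_atTop (2 * L'), Filter.eventually_gt_atTop 0] with n hn hn0
    have h2 := ENNReal.toReal_mono (by finiteness) (hL' n hn)
    rw [ENNReal.toReal_add (by finiteness) (by finiteness)] at h2
    simp only [ENNReal.toReal_mul, ENNReal.toReal_pow, ENNReal.toReal_natCast,
      ENNReal.toReal_ofReal hc, ← measureReal_def] at h2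
    rw [Nat.cast_sub hn] at h2
    have hn1 : (0 : ℝ) < n := by exact_mod_cast hn0
    have h3 : ((n - (2 * L' : ℕ) : ℝ)) ^ d = (n : ℝ) ^ d * (1 - 2 * L' / (n : ℝ)) ^ d := by
      rw [← mul_pow]
      congr 1
      push_cast
      field_simp
    rw [h3] at h2
    have hnd : (0 : ℝ) < (n : ℝ) ^ d := pow_pos hn1 d
    refine le_of_mul_le_mul_left ?_ hnd
    linarith
  have hlim : Filter.Tendsto (fun L => μ.real {ω | SurroundedAt (X ω).pts 0 L}) Filter.atTop
      (nhds (μ.real {ω | (X ω).pts.Nonempty})) := by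
    have hmono : Monotone fun L => {ω | SurroundedAt (X ω).pts 0 L} := fun L L' h ω hω =>
      surroundedAt_mono _ _ h hω
    have h2 := tendsto_measure_iUnion_atTop (μ := μ) hmono
    have h3 : μ (⋃ L, {ω | SurroundedAt (X ω).pts 0 L}) = μ {ω | (X ω).pts.Nonempty} := by
      refine measure_congr ?_
      filter_upwards [hs.ae_surroundedAt hX] with ω hω
      refine propext (?_ : ω ∈ ⋃ L, {ω | SurroundedAt (X ω).pts 0 L} ↔ (X ω).pts.Nonempty)
      rw [mem_iUnion]
      exact ⟨fun ⟨L, _, _, ⟨v, hv, _⟩, _⟩ => ⟨v, hv⟩, fun h => hω h 0⟩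
    rw [h3] at h2
    exact (ENNReal.tendsto_toReal (measure_ne_top _ _)).comp h2
  exact le_of_tendsto' ((hlim.const_mul _).const_add _) hL

theorem IsStationary.measure_nearBoundary_le {μ : Measure Ω} [IsProbabilityMeasure μ]
    {X : Ω → Config d} (hX : AEMeasurable X μ) (hs : IsStationary μ X) {r R : ℝ} (hr : 0 < r)
    (hR : 0 < R) (hsep : ∀ᵐ ω ∂μ, (X ω).pts.Pairwise fun x y => 2 * r ≤ dist x y) :
    μ {ω | NearBoundary (X ω).pts 0 R} ≤ ENNReal.ofReal ((d + 1) * ((R + √d) / r)) := by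
  rw [← ofReal_measureReal]
  refine ENNReal.ofReal_le_ofReal ?_
  set t := (R + √d) / r with ht
  have h0 : 0 < t := by positivity
  have hd : (0 : ℝ) ≤ d := d.cast_nonneg
  rcases le_or_gt t 1 with h1 | h1
  · have h2 := hs.measure_nearBoundary_add_le hX hr hsep h0 h1 (div_mul_cancel₀ _ hr.ne').ge
    -- Bernoulli gives the bound `d * t`; the factor `d + 1` in the statement makes the bound exceed
    -- `1` in the case `t > 1`.
    have h3 := one_add_mul_le_pow (show -2 ≤ -t by linarith) d
    rw [← sub_eq_add_neg] at h3
    have h4 : μ.real {ω | (X ω).pts.Nonempty} ≤ 1 := measureReal_le_one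
    have h5 : (0 : ℝ) ≤ μ.real {ω | (X ω).pts.Nonempty} := measureReal_nonneg
    have h6 : (0 : ℝ) ≤ d * t := by positivity
    nlinarith
  · exact measureReal_le_one.trans (by nlinarith)

/-- If the sites become sparse at an exponential rate, then almost surely a bounded set meets only
finitely many of the Voronoi boundaries. -/
theorem ae_eventually_not_nearBoundary {μ : Measure Ω} [IsProbabilityMeasure μ]
    {X : ℕ → Ω → Config d} (hX : ∀ k, AEMeasurable (X k) μ) (hs : ∀ k, IsStationary μ (X k))
    (hsep : ∀ k, ∀ᵐ ω ∂μ, (X k ω).pts.Pairwise fun x y => (2 : ℝ) ^ k ≤ dist x y) :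
    ∀ᵐ ω ∂μ, ∀ R : ℕ, ∀ᶠ k in Filter.atTop, ¬ NearBoundary (X k ω).pts 0 R := by
  refine ae_all_iff.2 fun R => ?_
  -- The radius `R + 1` is positive also for `R = 0`, as the estimate requires.
  have h : ∀ᵐ ω ∂μ, ∀ᶠ k in Filter.atTop, ¬ NearBoundary (X k ω).pts 0 (R + 1) := by
    refine ae_eventually_notMem (s := fun k => {ω | NearBoundary (X k ω).pts 0 (R + 1)}) ?_
    have hsum : Summable fun k : ℕ => (d + 1) * ((R + 1 + √d) / ((2 : ℝ) ^ k / 2)) := by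
      have := (summable_geometric_two).mul_left ((d + 1) * (R + 1 + √d) * 2)
      refine this.congr fun k => ?_
      rw [one_div, inv_pow]
      field_simp
    refine ne_top_of_le_ne_top hsum.tsum_ofReal_ne_top (ENNReal.tsum_le_tsum fun k => ?_)
    refine (hs k).measure_nearBoundary_le (hX k) (by positivity) (by positivity) ?_
    filter_upwards [hsep k] with ω hω
    rwa [mul_div_cancel₀ _ (two_ne_zero)]
  filter_upwards [h] with ω hω
  filter_upwards [hω] with k hk hk'
  exact hk (hk'.mono (by gcongr; linarith))

end Stationary

/-! ### Components as chains of basic open sets -/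

section Chains

/-- Two sets of the family `b` are linked inside `U` if both lie in `U` and they intersect. -/
def Linked {E ι : Type*} (b : ι → Set E) (U : Set E) (i j : ι) : Prop :=
  b i ⊆ U ∧ b j ⊆ U ∧ (b i ∩ b j).Nonempty

theorem subset_connectedComponentIn_of_linked {E ι : Type*} [TopologicalSpace E] {b : ι → Set E}
    (hb : ∀ i, IsPreconnected (b i)) {U : Set E} {i j : ι} {x : E} (hx : x ∈ b i) (hi : b i ⊆ U)
    (h : Relation.ReflTransGen (Linked b U) i j) : b j ⊆ connectedComponentIn U x := by
  induction h with
  | refl => exact (hb i).subset_connectedComponentIn hx hi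
  | tail _ hl ih =>
    obtain ⟨-, hj, z, hz, hz'⟩ := hl
    rw [connectedComponentIn_eq (ih hz)]
    exact (hb _).subset_connectedComponentIn hz' hj

/-- Two points of an open set lie in the same component iff they are joined by a finite chain
of basic connected sets. -/
theorem mem_connectedComponentIn_iff_linked {E ι : Type*} [TopologicalSpace E] {b : ι → Set E}
    (hb : ∀ i, IsPreconnected (b i)) (hbo : ∀ i, IsOpen (b i)) {U : Set E}
    (hU : ∀ x ∈ U, ∃ i, x ∈ b i ∧ b i ⊆ U) {x y : E} :
    y ∈ connectedComponentIn U x ↔ ∃ i j, x ∈ b i ∧ y ∈ b j ∧ b i ⊆ U ∧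
      Relation.ReflTransGen (Linked b U) i j := by
  refine ⟨fun hy => ?_, fun ⟨i, j, hx, hy, hi, h⟩ =>
    subset_connectedComponentIn_of_linked hb hx hi h hy⟩
  have hxU : x ∈ U := connectedComponentIn_nonempty_iff.1 ⟨y, hy⟩
  -- Recording `b j ⊆ U` as well makes the relation symmetric and transitive.
  refine isPreconnected_connectedComponentIn.induction₂ (s := connectedComponentIn U x)
    (fun x y => ∃ i j, x ∈ b i ∧ y ∈ b j ∧ b i ⊆ U ∧ b j ⊆ U ∧
      Relation.ReflTransGen (Linked b U) i j) (fun z hz => ?_) ?_ ?_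
      (mem_connectedComponentIn hxU) hy |> fun ⟨i, j, h1, h2, h3, _, h5⟩ => ⟨i, j, h1, h2, h3, h5⟩
  · obtain ⟨i, hi, hiU⟩ := hU z (connectedComponentIn_subset _ _ hz)
    filter_upwards [mem_nhdsWithin_of_mem_nhds ((hbo i).mem_nhds hi)] with w hw
    exact ⟨i, i, hi, hw, hiU, hiU, .refl⟩
  · rintro x y z _ _ _ ⟨i, j, hx, hy, hi, hj, h⟩ ⟨i', j', hy', hz, hi', hj', h'⟩
    exact ⟨i, j', hx, hz, hi, hj', (h.tail ⟨hj, hi', y, hy, hy'⟩).trans h'⟩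
  · rintro x y _ _ ⟨i, j, hx, hy, hi, hj, h⟩
    have : Std.Symm (Linked b U) := ⟨fun i j ⟨h1, h2, h3⟩ => ⟨h2, h1, by rwa [inter_comm]⟩⟩
    exact ⟨j, i, hy, hx, hj, hi, Relation.ReflTransGen.stdSymm.symm _ _ h⟩

/-- A countable index type has only countably many finite lists, and each being a chain is a finite
intersection of events. -/
theorem nullMeasurableSet_reflTransGen {Ω ι : Type*} [MeasurableSpace Ω] {μ : Measure Ω}
    [Countable ι] {r : Ω → ι → ι → Prop} (hr : ∀ i j, NullMeasurableSet {ω | r ω i j} μ) (i j : ι) :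
    NullMeasurableSet {ω | Relation.ReflTransGen (r ω) i j} μ := by
  have hchain : ∀ (l : List ι) (i : ι), NullMeasurableSet {ω | (i :: l).IsChain (r ω)} μ := by
    intro l
    induction l with
    | nil => intro i; simp
    | cons a l ih =>
      intro i
      simp only [List.isChain_cons_cons]
      exact (hr i a).inter (ih a)
  have : {ω | Relation.ReflTransGen (r ω) i j} =
      ⋃ l : {l : List ι // (i :: l).getLast (List.cons_ne_nil _ _) = j},
        {ω | (i :: l.1).IsChain (r ω)} := by
    ext ω
    simp only [mem_ofPred_eq, mem_iUnion]
    constructor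
    · intro h
      obtain ⟨l, hl, hlast⟩ := List.exists_isChain_cons_of_relationReflTransGen h
      exact ⟨⟨l, hlast⟩, hl⟩
    · rintro ⟨⟨l, rfl⟩, hl⟩
      exact List.relationReflTransGen_of_exists_isChain_cons l hl rfl
  rw [this]
  exact .iUnion fun l => hchain l.1 i

end Chains

/-! ### The clumps -/

section Clumps

variable {d : ℕ}

/-- Equivariance moves the translation from `V ω` to `ω`, where the law is invariant. -/
theorem IsEquivariantSubset.isStationary {μ : Measure (Config d)} (hinv : IsometryInvariant μ)
    {V : Config d → Config d} (hV : IsEquivariantSubset μ V) : IsStationary μ V := by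
  intro a E hE
  have hpres : MeasurePreserving (Config.map (IsometryEquiv.addRight a)) μ μ :=
    ⟨Config.measurable_map _, hinv _⟩
  refine Eq.trans (measure_congr ?_)
    (hpres.measure_preimage (hV.aemeasurable.nullMeasurableSet_preimage hE))
  filter_upwards [hV.equivariant] with ω hω
  refine propext (?_ : (V ω).map _ ∈ E ↔ V (ω.map _) ∈ E)
  rw [hω]

theorem boundaryCompl_mono (V : ℕ → Config d → Config d) (ω : Config d) :
    Monotone fun k => boundaryCompl V k ω := fun _ _ h =>
  compl_subset_compl.2 (biUnion_mono (fun _ hi => h.trans hi) fun _ _ => Subset.rfl)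

theorem clumps_iff {V : ℕ → Config d → Config d} {k : ℕ} {ω : Config d} {x y : ω.pts} :
    clumps V k ω x y ↔
      x = y ∨ (y : Space d) ∈ connectedComponentIn (boundaryCompl V k ω) x :=
  Iff.rfl

theorem clumps_le_succ (V : ℕ → Config d → Config d) (k : ℕ) (ω : Config d) :
    clumps V k ω ≤ clumps V (k + 1) ω := by
  rintro x y (h | h)
  · exact Or.inl h
  · exact Or.inr (connectedComponentIn_mono _ (boundaryCompl_mono V ω k.le_succ) h)

theorem boundaryCompl_map {V : ℕ → Config d → Config d} {ω : Config d} {γ : Space d ≃ᵢ Space d}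
    (h : ∀ k, V k (ω.map γ) = (V k ω).map γ) (k : ℕ) :
    boundaryCompl V k (ω.map γ) = γ '' boundaryCompl V k ω := by
  rw [boundaryCompl, boundaryCompl, image_compl_eq γ.bijective, image_iUnion₂]
  refine congrArg _ (iUnion₂_congr fun i _ => ?_)
  rw [h, ← voronoiBoundary_image]
  rfl

theorem clumps_map_iff {V : ℕ → Config d → Config d} {ω : Config d} {γ : Space d ≃ᵢ Space d}
    (h : ∀ k, V k (ω.map γ) = (V k ω).map γ) (k : ℕ) (x y : ω.pts) :
    clumps V k (ω.map γ) (ω.mapPt γ x) (ω.mapPt γ y) ↔ clumps V k ω x y := by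
  refine or_congr ?_ ?_
  · simp [Config.mapPt, Subtype.ext_iff]
  · rw [boundaryCompl_map h]
    simp only [Config.mapPt]
    by_cases hx : (x : Space d) ∈ boundaryCompl V k ω
    · have := γ.toHomeomorph.image_connectedComponentIn hx
      simp only [IsometryEquiv.coe_toHomeomorph] at this
      rw [← this, γ.injective.mem_set_image]
    · rw [connectedComponentIn_eq_empty hx, connectedComponentIn_eq_empty]
      · simp
      · rwa [γ.injective.mem_set_image]

/-- Only finitely many of the Voronoi boundaries meet a given ball. -/
def LocallyFiniteBoundaries (V : ℕ → Config d → Config d) (ω : Config d) : Prop :=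
  ∀ R : ℕ, ∀ᶠ k in Filter.atTop, ¬ NearBoundary (V k ω).pts 0 R

/-- Near a point only finitely many of the closed boundaries matter, so their union is closed. -/
theorem LocallyFiniteBoundaries.isOpen_boundaryCompl {V : ℕ → Config d → Config d} {ω : Config d}
    (h : LocallyFiniteBoundaries V ω) (k : ℕ) : IsOpen (boundaryCompl V k ω) := by
  rw [isOpen_iff_mem_nhds]
  intro x hx
  obtain ⟨R, hR⟩ := exists_nat_gt ‖x‖
  obtain ⟨m, hm⟩ := Filter.eventually_atTop.1 (h R)
  have h1 : ∀ i ∈ Iio m, k ≤ i → (voronoiBoundary (V i ω).pts)ᶜ ∈ nhds x := fun i _ hi =>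
    (V i ω).isClosed_voronoiBoundary.isOpen_compl.mem_nhds fun hxi =>
      hx (mem_iUnion₂.2 ⟨i, hi, hxi⟩)
  have h2 : ∀ᶠ y in nhds x, ∀ i ∈ Iio m, k ≤ i → y ∉ voronoiBoundary (V i ω).pts :=
    (Set.finite_Iio m).eventually_all.2 fun i hi => by
      by_cases hk : k ≤ i
      · filter_upwards [h1 i hi hk] with y hy _ using hy
      · exact Filter.Eventually.of_forall fun _ h => absurd h hk
  filter_upwards [h2, Metric.isOpen_ball.mem_nhds (mem_ball_zero_iff.2 hR)] with y hy hyR hyU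
  obtain ⟨i, hi, hyi⟩ := mem_iUnion₂.1 hyU
  rcases lt_or_ge i m with him | him
  · exact hy i him hi hyi
  · exact hm i him ⟨y, hyR, hyi⟩

theorem LocallyFiniteBoundaries.exists_clumps {V : ℕ → Config d → Config d} {ω : Config d}
    (h : LocallyFiniteBoundaries V ω) (x y : ω.pts) : ∃ k, clumps V k ω x y := by
  obtain ⟨R, hR⟩ := exists_nat_gt (max ‖(x : Space d)‖ ‖(y : Space d)‖)
  obtain ⟨m, hm⟩ := Filter.eventually_atTop.1 (h R)
  have hsub : Metric.ball (0 : Space d) R ⊆ boundaryCompl V m ω := by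
    intro z hz hzU
    obtain ⟨i, hi, hzi⟩ := mem_iUnion₂.1 hzU
    exact hm i hi ⟨z, hz, hzi⟩
  exact ⟨m, Or.inr ((convex_ball (0 : Space d) R).isPreconnected.subset_connectedComponentIn
    (mem_ball_zero_iff.2 ((le_max_left _ _).trans_lt hR)) hsub
    (mem_ball_zero_iff.2 ((le_max_right _ _).trans_lt hR)))⟩

/-- A component avoids the boundary of level `k`, so it stays in one bounded cell, which contains
finitely many points of `ω`. -/
theorem finite_clump {V : ℕ → Config d → Config d} {k : ℕ} {ω : Config d}
    (hne : (V k ω).pts.Nonempty)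
    (hbdd : ∀ v ∈ (V k ω).pts, Bornology.IsBounded (voronoiCell (V k ω).pts v)) (x : ω.pts) :
    {y : ω.pts | clumps V k ω x y}.Finite := by
  obtain ⟨v, hv, hxv⟩ := (V k ω).exists_mem_voronoiCell hne x
  refine (((ω.finite_inter _ (hbdd v hv)).preimage Subtype.val_injective.injOn).union
    (finite_singleton x)).subset ?_
  rintro y (h | h)
  · exact Or.inr h.symm
  · have hxU : (x : Space d) ∈ boundaryCompl V k ω := connectedComponentIn_nonempty_iff.1 ⟨_, h⟩
    refine Or.inl ⟨y.2, subset_voronoiCell_of_isPreconnected isPreconnected_connectedComponentIn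
      ?_ hv (mem_connectedComponentIn hxU) hxv h⟩
    refine Set.disjoint_left.2 fun z hz hzb => connectedComponentIn_subset _ _ hz ?_
    exact mem_iUnion₂.2 ⟨k, le_rfl, hzb⟩

/-- A countable family of balls that contains a basis of the topology. -/
noncomputable def basicBall (d : ℕ) (i : ℕ × ℚ) : Set (Space d) :=
  Metric.ball (TopologicalSpace.denseSeq (Space d) i.1) i.2

theorem exists_basicBall {U : Set (Space d)} (hU : IsOpen U) {x : Space d} (hx : x ∈ U) :
    ∃ i, x ∈ basicBall d i ∧ basicBall d i ⊆ U := by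
  obtain ⟨ε, hε, hεU⟩ := Metric.isOpen_iff.1 hU x hx
  obtain ⟨_, ⟨n, rfl⟩, -, ρ, h1, h2⟩ := exists_dense_rat_ball
    (TopologicalSpace.denseRange_denseSeq (Space d)) isOpen_univ (mem_univ x) hε
  exact ⟨(n, ρ), h1 (Metric.mem_closedBall_self le_rfl), h2.trans hεU⟩

theorem nullMeasurableSet_subset_boundaryCompl {μ : Measure (Config d)}
    {V : ℕ → Config d → Config d} (hV : ∀ k, AEMeasurable (V k) μ) (k : ℕ) {B : Set (Space d)}
    (hB : IsOpen B) (hBc : IsPreconnected B) :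
    NullMeasurableSet {ω | B ⊆ boundaryCompl V k ω} μ := by
  have : {ω | B ⊆ boundaryCompl V k ω} =
      ⋂ i ∈ Ici k, (V i ⁻¹' {S | (B ∩ voronoiBoundary S.pts).Nonempty})ᶜ := by
    ext ω
    simp only [boundaryCompl, mem_ofPred_eq, subset_compl_iff_disjoint_right, disjoint_iUnion_right,
      mem_iInter, mem_compl_iff, mem_preimage, not_nonempty_iff_eq_empty,
      ← disjoint_iff_inter_eq_empty, mem_Ici, ge_iff_le]
  rw [this]
  exact .biInter (to_countable _) fun i _ => ((hV i).nullMeasurableSet_preimage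
    (Config.measurableSet_hit_voronoiBoundary hB hBc)).compl

theorem nullMeasurableSet_exists_clumps {μ : Measure (Config d)} {V : ℕ → Config d → Config d}
    (hV : ∀ k, AEMeasurable (V k) μ) (hloc : ∀ᵐ ω ∂μ, LocallyFiniteBoundaries V ω) (k : ℕ)
    {A A' : Set (Space d)} (hA : MeasurableSet A) (hA' : MeasurableSet A') :
    NullMeasurableSet {ω : Config d | ∃ x y : ω.pts, (x : Space d) ∈ A ∧ (y : Space d) ∈ A' ∧
      clumps V k ω x y} μ := by
  have hbo : ∀ i, IsOpen (basicBall d i) := fun i => Metric.isOpen_ball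
  have hbc : ∀ i, IsPreconnected (basicBall d i) := fun i => (convex_ball _ _).isPreconnected
  have hsub : ∀ i, NullMeasurableSet {ω | basicBall d i ⊆ boundaryCompl V k ω} μ := fun i =>
    nullMeasurableSet_subset_boundaryCompl hV k (hbo i) (hbc i)
  have hlink : ∀ i j, NullMeasurableSet {ω | Linked (basicBall d) (boundaryCompl V k ω) i j} μ :=
    fun i j => (hsub i).inter ((hsub j).inter (.const _))
  have hit : ∀ {B : Set (Space d)}, MeasurableSet B →
      NullMeasurableSet {ω : Config d | (ω.pts ∩ B).Nonempty} μ := fun hB =>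
    (Config.measurableSet_hit hB).nullMeasurableSet
  have hmeas : NullMeasurableSet ({ω : Config d | (ω.pts ∩ (A ∩ A')).Nonempty} ∪
      ⋃ i, ⋃ j, {ω : Config d | (ω.pts ∩ (A ∩ basicBall d i)).Nonempty} ∩
        ({ω : Config d | (ω.pts ∩ (A' ∩ basicBall d j)).Nonempty} ∩
          ({ω | basicBall d i ⊆ boundaryCompl V k ω} ∩
            {ω | Relation.ReflTransGen (Linked (basicBall d) (boundaryCompl V k ω)) i j}))) μ :=
    (hit (hA.inter hA')).union <| .iUnion fun i => .iUnion fun j =>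
      (hit (hA.inter (hbo i).measurableSet)).inter <| (hit (hA'.inter (hbo j).measurableSet)).inter
        ((hsub i).inter (nullMeasurableSet_reflTransGen hlink i j))
  -- Chains describe components only where the complement is open, which holds almost surely; hence
  -- null-measurability.
  refine hmeas.congr (Filter.eventuallyEq_set.2 ?_)
  filter_upwards [hloc] with ω hω
  refine Iff.symm ?_
  simp only [clumps_iff, mem_connectedComponentIn_iff_linked hbc hbo
    fun x hx => exists_basicBall (hω.isOpen_boundaryCompl k) hx]
  simp only [mem_union, mem_iUnion, mem_inter_iff, mem_ofPred_eq]
  constructor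
  · rintro ⟨x, y, hx, hy, rfl | ⟨i, j, hxi, hyj, hi, hij⟩⟩
    · exact Or.inl ⟨x, x.2, hx, hy⟩
    · exact Or.inr ⟨i, j, ⟨x, x.2, hx, hxi⟩, ⟨y, y.2, hy, hyj⟩, hi, hij⟩
  · rintro (⟨x, hx, hxA, hxA'⟩ | ⟨i, j, ⟨x, hx, hxA, hxi⟩, ⟨y, hy, hyA, hyj⟩, hi, hij⟩)
    · exact ⟨⟨x, hx⟩, ⟨x, hx⟩, hxA, hxA', Or.inl rfl⟩
    · exact ⟨⟨x, hx⟩, ⟨y, hy⟩, hxA, hyA, Or.inr ⟨i, j, hxi, hyj, hi, hij⟩⟩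

end Clumps

end PointProcess

theorem mainTheorem4 (d : ℕ) (μ : Measure (PointProcess.Config d)) [IsProbabilityMeasure μ]
    (hinv : PointProcess.IsometryInvariant μ) (hfin : PointProcess.FiniteIntensity μ)
    (V : ℕ → PointProcess.Config d → PointProcess.Config d)
    (hV : ∀ k, PointProcess.IsEquivariantSubset μ (V k))
    (hne : ∀ k, ∀ᵐ ω ∂μ, ω.pts.Nonempty → (V k ω).pts.Nonempty)
    (hsep : ∀ k, ∀ᵐ ω ∂μ, (V k ω).pts.Pairwise fun x y => (2 : ℝ) ^ k ≤ dist x y) :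
    PointProcess.IsLocallyFiniteClumping μ (PointProcess.clumps V) ∧
      PointProcess.IsConnectedClumping μ (PointProcess.clumps V) := by
  have hs := fun k => (hV k).isStationary hinv
  have hloc : ∀ᵐ ω ∂μ, PointProcess.LocallyFiniteBoundaries V ω :=
    PointProcess.ae_eventually_not_nearBoundary (fun k => (hV k).aemeasurable) hs hsep
  refine ⟨⟨?_, ?_, ?_, ?_⟩, ?_⟩
  · exact Filter.Eventually.of_forall fun ω k => PointProcess.clumps_le_succ V k ω
  · refine ae_all_iff.2 fun k => ?_
    filter_upwards [hne k, (hs k).ae_surroundedAt (hV k).aemeasurable] with ω hω hsur x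
    refine PointProcess.finite_clump (hω ⟨x, x.2⟩) (fun v hv => ?_) x
    -- The site itself serves as centre `p` and as the point of its cell close to `p`.
    obtain ⟨L, hL⟩ := hsur ⟨v, hv⟩ v
    obtain ⟨L', hL'⟩ := PointProcess.exists_voronoiCell_subset_ball_of_surroundedAt d L
    exact Metric.isBounded_ball.subset
      (hL' _ v hL v hv v (fun w _ => by simp) (by simp))
  · filter_upwards [ae_all_iff.2 fun k => (hV k).equivariant] with ω hω γ k x y
    exact PointProcess.clumps_map_iff (fun k => hω k γ) k x y
  · exact fun k A A' hA hA' => PointProcess.nullMeasurableSet_exists_clumps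
      (fun k => (hV k).aemeasurable) hloc k hA hA'
  · filter_upwards [hloc] with ω hω x y
    exact hω.exists_clumps x y
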